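/- Let $\alpha<0$, $0<p<\infty$, and let $f:\mathbb C\to\mathbb C$ be entire and not identically zero. For $r>0$ put $$\mathsf M_{p,\alpha}(f,r)=\frac{\int_{|z|\le r}|f(z)|^p e^{-\alpha|z|^2}\,dA(z)}{\int_{|z|\le r}e^{-\alpha|z|^2}\,dA(z)},$$ where $dA$ is Euclidean area measure on $\mathbb C$. For $x>0$ put $$\varphi(x)=\frac{1-e^{-\alpha x}}{\alpha},\qquad M(x)=\int_0^{2\pi}|f(\sqrt x\,e^{i\theta})|^p\,d\theta ,$$ and let $x_0$ be the unique zero of $x(1-\alpha x)-\varphi(x)$ on $(0,\infty)$. Suppose that $$\left(x\frac{M'(x)}{M(x)}\right)'\ \ge\ \frac{[x(1-\alpha x)-\varphi(x)]^2}{4x[\varphi(x)-x]^2}$$ for every $x\ge x_0$ at which the derivative on the left exists. (The left-hand derivative exists for all $x>0$ outside a set of isolated points, where it is $+\infty$; such points can occur only if $p\le 1$ and $f$ has a zero on $|z|=\sqrt x$.) Then the function $r\mapsto\ln\mathsf M_{p,\alpha}(f,r)$ is convex in $\ln r$ for $r\in(0,\infty)$. -/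

import Mathlib

open Real MeasureTheory Set

noncomputable section

/-- The Gaussian integral mean `M_{p,α}(f,r)`: the average of `|f|^p` over the disc `|z| ≤ r`
with respect to the weight `e^{-α|z|²} dA`, where `dA` is Euclidean area measure on `ℂ`. -/
def gaussianMean (p α : ℝ) (f : ℂ → ℂ) (r : ℝ) : ℝ :=
  (∫ z in Metric.closedBall (0 : ℂ) r, ‖f z‖ ^ p * Real.exp (-α * ‖z‖ ^ 2)) /
    (∫ z in Metric.closedBall (0 : ℂ) r, Real.exp (-α * ‖z‖ ^ 2))

/-- `M(x) = ∫₀^{2π} |f(√x e^{iθ})|^p dθ`. -/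
def circleMean (p : ℝ) (f : ℂ → ℂ) (x : ℝ) : ℝ :=
  ∫ θ in (0 : ℝ)..(2 * π), ‖f ((√x : ℂ) * Complex.exp (θ * Complex.I))‖ ^ p

/-- `φ(x) = (1 - e^{-αx}) / α`. -/
def gaussPhi (α x : ℝ) : ℝ := (1 - Real.exp (-α * x)) / α

/-- The logarithmic derivative `x M'(x) / M(x)` of `M` with respect to `ln x`. -/
def circleMeanLogDeriv (p : ℝ) (f : ℂ → ℂ) (x : ℝ) : ℝ :=
  x * (deriv (circleMean p f) x / circleMean p f x)

/-- `F(r)` is convex in `ln r` for `r ∈ (0, ∞)`: with `r = e^t`, the function `t ↦ F(e^t)` is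
convex on the real line. -/
def ConvexInLog (F : ℝ → ℝ) : Prop :=
  ConvexOn ℝ Set.univ (fun t : ℝ => F (Real.exp t))

end

open scoped Topology

open Filter

/-! Put `a = -α`, `t = ln x = 2 ln r`, `y = a e^t`, `N(t) = ln M(e^t)`, `m` the right derivative of
`N`, `h(t) = ∫_0^{e^t} M(u) e^{au} du` and `E = h'`. Up to a constant, the logarithm of the Gaussian
mean is `ln h - ln(e^y - 1)`, whose derivative is `u - v` with `u = E/h` and `v = y e^y/(e^y - 1)`.
Writing `T = y/(e^y - 1)` and `w = 1 - T`, one has `v' = vw` and, off the exceptional points, `E'/E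
= 1 + y + m = v + w + m`. Convexity therefore says `u² - (v + w + m)u + vw ≤ 0`: the quotient `u`
must lie between the roots of a quadratic.

Lower root: the quadratic equals `-mv ≤ 0` at `v`, and `u ≥ v` because `M` is nondecreasing.

Upper root `U`: `u ≤ U` means `h - E/U ≥ 0`. This function is at least `-E`, which tends to 0 at
`-∞`, and its derivative is `E(U' - vw)/U²`. Implicit differentiation turns `U' ≥ vw` into `m' ≥ (1
- q)(w² q - (y - vw))` with `q = v/U ≤ 1`. Maximising over real `q` gives exactly the assumed bound,
used for `x ≥ x₀`. For `x < x₀` the right side is nonpositive, and `m' ≥ 0` suffices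
(`convexOn_log_sub_log`).

That `N` is convex is Hardy's theorem, obtained by replacing `|f|^p` with `(|f|² + ε)^{p/2}`, using
log-subharmonicity, and letting `ε → 0`. Radii of circles carrying zeros of `f` are isolated; there
`m` can only jump upwards, which raises `U` and hence `h - E/U`, so monotonicity survives
(`monotone_of_eventually_hasDerivAt_nonneg`). -/

/-! ### A monotonicity criterion with isolated upward jumps -/

/-- A function that is monotone near every point of the line is monotone. -/
theorem monotone_of_locally_monotoneOn {G : ℝ → ℝ}
    (h : ∀ s, ∃ a b, a < s ∧ s < b ∧ MonotoneOn G (Ioo a b)) : Monotone G := by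
  have key : ∀ x y : ℝ, MonotoneOn G (uIcc x y) := by
    -- Being monotone on the segment between two points is a local and transitive relation, so
    -- connectedness of the line gives it for all pairs.
    refine PreconnectedSpace.induction₂' _ (fun s => ?_) ⟨fun x y z hxy hyz => ?_⟩
    · obtain ⟨a, b, has, hsb, hG⟩ := h s
      filter_upwards [Ioo_mem_nhds has hsb] with t ht
      have hsub : uIcc s t ⊆ Ioo a b := ordConnected_Ioo.uIcc_subset ⟨has, hsb⟩ ht
      exact ⟨hG.mono hsub, by rw [uIcc_comm]; exact hG.mono hsub⟩
    · intro u hu w hw huw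
      by_cases h1 : u ∈ uIcc x y <;> by_cases h2 : w ∈ uIcc x y
      · exact hxy h1 h2 huw
      · have h3 : w ∈ uIcc y z := (uIcc_subset_uIcc_union_uIcc hw).resolve_left h2
        have hy : u ≤ y ∧ y ≤ w ∨ (u ∈ uIcc y z) := by
          simp only [mem_uIcc] at *
          grind
        rcases hy with ⟨h4, h5⟩ | h4
        · exact (hxy h1 right_mem_uIcc h4).trans (hyz left_mem_uIcc h3 h5)
        · exact hyz h4 h3 huw
      · have h3 : u ∈ uIcc y z := (uIcc_subset_uIcc_union_uIcc hu).resolve_left h1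
        have hy : u ≤ y ∧ y ≤ w ∨ (w ∈ uIcc y z) := by
          simp only [mem_uIcc] at *
          grind
        rcases hy with ⟨h4, h5⟩ | h4
        · exact (hyz h3 left_mem_uIcc h4).trans (hxy right_mem_uIcc h2 h5)
        · exact hyz h3 h4 huw
      · exact hyz ((uIcc_subset_uIcc_union_uIcc hu).resolve_left h1)
          ((uIcc_subset_uIcc_union_uIcc hw).resolve_left h2) huw
  intro x y hxy
  exact key x y left_mem_uIcc right_mem_uIcc hxy

/-- If `t ↦ Φ t (m t)` has nonnegative derivative off a discrete set, where `m` is monotone and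
`Φ` is continuous in the first and monotone in the second variable, then it is monotone: it can
only jump upwards. -/
theorem monotone_of_eventually_hasDerivAt_nonneg {Φ : ℝ → ℝ → ℝ} {m : ℝ → ℝ}
    (hcont : ∀ μ, 0 ≤ μ → Continuous fun t => Φ t μ)
    (hΦ : ∀ t, MonotoneOn (Φ t) (Ici 0)) (hm : Monotone m) (hm0 : ∀ t, 0 ≤ m t)
    (hd : ∀ s, ∀ᶠ t in 𝓝[≠] s, ∃ d, 0 ≤ d ∧ HasDerivAt (fun t => Φ t (m t)) d t) :
    Monotone fun t => Φ t (m t) := by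
  apply monotone_of_locally_monotoneOn
  intro s
  obtain ⟨a, b, ⟨has, hsb⟩, hab⟩ := mem_nhds_iff_exists_Ioo_subset.1
    (eventually_nhdsWithin_iff.1 (hd s))
  have hmono : ∀ c d, Ioo c d ⊆ Ioo a b → s ∉ Ioo c d →
      MonotoneOn (fun t => Φ t (m t)) (Ioo c d) := by
    intro c d hsub hs
    have hD : ∀ t ∈ Ioo c d, ∃ d, 0 ≤ d ∧ HasDerivAt (fun t => Φ t (m t)) d t := fun t ht =>
      hab (hsub ht) (fun h => hs (h ▸ ht))
    refine monotoneOn_of_deriv_nonneg (convex_Ioo c d) ?_ ?_ ?_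
    · intro t ht
      obtain ⟨d, -, h⟩ := hD t ht
      exact h.continuousAt.continuousWithinAt
    · intro t ht
      rw [interior_Ioo] at ht
      obtain ⟨d, -, h⟩ := hD t ht
      exact h.differentiableAt.differentiableWithinAt
    · intro t ht
      rw [interior_Ioo] at ht
      obtain ⟨d, hd0, h⟩ := hD t ht
      rwa [h.deriv]
  have hL := hmono a s (Ioo_subset_Ioo_right hsb.le) (fun h => lt_irrefl _ h.2)
  have hR := hmono s b (Ioo_subset_Ioo_left has.le) (fun h => lt_irrefl _ h.1)
  have hcs := (hcont (m s) (hm0 s)).tendsto s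
  -- Freezing the second variable at `m s` costs an inequality in the right direction, since `m` is
  -- monotone; what remains is continuous in `t`, so the limit at `s` can be taken.
  have hleft : ∀ t ∈ Ioo a s, Φ t (m t) ≤ Φ s (m s) := by
    intro t ht
    refine ge_of_tendsto (hcs.mono_left nhdsWithin_le_nhds : Tendsto _ (𝓝[<] s) _) ?_
    filter_upwards [Ioo_mem_nhdsLT ht.2] with t' ht'
    exact (hL ht ⟨ht.1.trans ht'.1, ht'.2⟩ ht'.1.le).trans
      (hΦ t' (hm0 t') (hm0 s) (hm ht'.2.le))
  have hright : ∀ t ∈ Ioo s b, Φ s (m s) ≤ Φ t (m t) := by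
    intro t ht
    refine le_of_tendsto (hcs.mono_left nhdsWithin_le_nhds : Tendsto _ (𝓝[>] s) _) ?_
    filter_upwards [Ioo_mem_nhdsGT ht.1] with t' ht'
    exact (hΦ t' (hm0 s) (hm0 t') (hm ht'.1.le)).trans
      (hR ⟨ht'.1, ht'.2.trans ht.2⟩ ht ht'.2.le)
  refine ⟨a, b, has, hsb, fun x hx y hy hxy => ?_⟩
  rcases lt_trichotomy x s with h1 | h1 | h1
  · rcases lt_trichotomy y s with h2 | h2 | h2
    · exact hL ⟨hx.1, h1⟩ ⟨hy.1, h2⟩ hxy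
    · subst h2
      exact hleft x ⟨hx.1, h1⟩
    · exact (hleft x ⟨hx.1, h1⟩).trans (hright y ⟨h2, hy.2⟩)
  · subst h1
    rcases hxy.eq_or_lt with h2 | h2
    · subst h2; exact le_rfl
    · exact hright y ⟨h2, hy.2⟩
  · exact hR ⟨h1, hx.2⟩ ⟨h1.trans_le hxy, hy.2⟩ hxy

/-! ### Elementary inequalities for `y / (e^y - 1)` -/

/-- The function `y / (e^y - 1)`. -/
noncomputable def bernoulliQuot (y : ℝ) : ℝ := y / (exp y - 1)

theorem exp_sub_one_pos {y : ℝ} (hy : 0 < y) : 0 < exp y - 1 := by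
  have := add_one_lt_exp hy.ne'
  linarith

theorem bernoulliQuot_pos {y : ℝ} (hy : 0 < y) : 0 < bernoulliQuot y :=
  div_pos hy (exp_sub_one_pos hy)

theorem bernoulliQuot_lt_one {y : ℝ} (hy : 0 < y) : bernoulliQuot y < 1 := by
  rw [bernoulliQuot, div_lt_one (exp_sub_one_pos hy)]
  have := add_one_lt_exp hy.ne'
  linarith

theorem one_sub_mul_exp_le_one (y : ℝ) : (1 - y) * exp y ≤ 1 := by
  have h := add_one_le_exp (-y)
  calc (1 - y) * exp y ≤ exp (-y) * exp y := by
        gcongr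
        linarith
    _ = 1 := by rw [← exp_add]; simp

theorem one_le_bernoulliQuot_add {y : ℝ} (hy : 0 < y) : 1 ≤ bernoulliQuot y + y := by
  have h : 1 - y ≤ bernoulliQuot y := by
    rw [bernoulliQuot, le_div_iff₀ (exp_sub_one_pos hy)]
    linarith [one_sub_mul_exp_le_one y]
  linarith

theorem one_lt_two_mul_bernoulliQuot_add {y : ℝ} (hy : 0 < y) :
    1 < 2 * bernoulliQuot y + y := by
  linarith [bernoulliQuot_pos hy, one_le_bernoulliQuot_add hy]

theorem hasDerivAt_bernoulliQuot_exp {a : ℝ} (ha : 0 < a) (t : ℝ) :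
    HasDerivAt (fun t => bernoulliQuot (a * exp t))
      (bernoulliQuot (a * exp t) * (1 - bernoulliQuot (a * exp t) - a * exp t)) t := by
  have hy : 0 < a * exp t := by positivity
  have h1 := (exp_sub_one_pos hy).ne'
  have hd : HasDerivAt (fun t => a * exp t) (a * exp t) t := (hasDerivAt_exp t).const_mul a
  have := hd.fun_div ((hd.exp).sub_const 1) h1
  refine this.congr_deriv ?_
  simp only [bernoulliQuot]
  field_simp
  ring

theorem hasDerivAt_log_exp_sub_one {a : ℝ} (ha : 0 < a) (t : ℝ) :
    HasDerivAt (fun t => log (exp (a * exp t) - 1)) (bernoulliQuot (a * exp t) + a * exp t) t := by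
  have hy : 0 < a * exp t := by positivity
  have h1 := (exp_sub_one_pos hy).ne'
  have hd : HasDerivAt (fun t => a * exp t) (a * exp t) t := (hasDerivAt_exp t).const_mul a
  refine (((hd.exp).sub_const 1).log h1).congr_deriv ?_
  simp only [bernoulliQuot]
  field_simp
  ring

/-- `e^y - 1 ≤ y (1 + y)` holds below any positive point of equality. -/
theorem exp_sub_one_le_of_le {y y₀ : ℝ} (hy : 0 < y) (h : y ≤ y₀)
    (h₀ : exp y₀ - 1 = y₀ * (1 + y₀)) : exp y - 1 ≤ y * (1 + y) := by
  -- This is the numerator of the derivative of `(e^z - 1 - z)/z²`. That quotient is therefore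
  -- increasing, and it equals 1 at `y₀`.
  have aux : ∀ z : ℝ, 0 ≤ z → 0 ≤ (z - 2) * exp z + z + 2 := by
    intro z hz
    have hd : ∀ z : ℝ, HasDerivAt (fun z => (z - 2) * exp z + z + 2) ((z - 1) * exp z + 1) z := by
      intro z
      have := ((((hasDerivAt_id z).sub_const 2).mul (hasDerivAt_exp z)).add
        (hasDerivAt_id z)).add_const 2
      refine (this.congr_deriv ?_)
      simp
      ring
    have hmono : Monotone (fun z : ℝ => (z - 2) * exp z + z + 2) := by
      apply monotone_of_deriv_nonneg (fun z => (hd z).differentiableAt)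
      intro z
      rw [(hd z).deriv]
      linarith [one_sub_mul_exp_le_one z]
    have := hmono hz
    simp at this
    linarith
  have hq : ∀ z : ℝ, 0 < z → HasDerivAt (fun z => (exp z - 1 - z) / z ^ 2)
      (((z - 2) * exp z + z + 2) / z ^ 3) z := by
    intro z hz
    have := (((hasDerivAt_exp z).sub_const 1).sub (hasDerivAt_id z)).fun_div (hasDerivAt_pow 2 z)
      (by positivity)
    refine this.congr_deriv ?_
    simp
    field_simp
    ring
  have hmono : MonotoneOn (fun z : ℝ => (exp z - 1 - z) / z ^ 2) (Ioi 0) := by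
    apply monotoneOn_of_deriv_nonneg (convex_Ioi 0)
    · exact fun z hz => (hq z hz).continuousAt.continuousWithinAt
    · intro z hz
      rw [interior_Ioi] at hz
      exact (hq z hz).differentiableAt.differentiableWithinAt
    · intro z hz
      rw [interior_Ioi] at hz
      rw [(hq z hz).deriv]
      have hz' : (0 : ℝ) < z := hz
      exact div_nonneg (aux z hz'.le) (by positivity)
  have hy0 : 0 < y₀ := hy.trans_le h
  have := hmono hy hy0 h
  simp only at this
  have e : (exp y₀ - 1 - y₀) / y₀ ^ 2 = 1 := by
    rw [h₀]
    field_simp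
    ring
  rw [e, div_le_one (by positivity)] at this
  linarith

/-! ### The larger root of the characteristic quadratic -/

/-- The larger root of `U² - (s + m) U + c`. -/
noncomputable def upperRoot (s c m : ℝ) : ℝ := (s + m + √((s + m) ^ 2 - 4 * c)) / 2

section upperRoot

variable {v w m : ℝ}

theorem upperRoot_disc_pos (hw : 0 ≤ w) (hvw : w < v) (hm : 0 ≤ m) :
    0 < (v + w + m) ^ 2 - 4 * (v * w) := by
  nlinarith [mul_pos (sub_pos.2 hvw) (sub_pos.2 hvw), mul_nonneg hm (hw.trans hvw.le),
    mul_nonneg hm hw, mul_nonneg hm hm]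

theorem upperRoot_quadratic (hw : 0 ≤ w) (hvw : w < v) (hm : 0 ≤ m) :
    upperRoot (v + w) (v * w) m ^ 2 - (v + w + m) * upperRoot (v + w) (v * w) m + v * w = 0 := by
  have := sq_sqrt (upperRoot_disc_pos hw hvw hm).le
  rw [upperRoot]
  linear_combination this / 4

theorem lt_two_mul_upperRoot (hw : 0 ≤ w) (hvw : w < v) (hm : 0 ≤ m) :
    v + w + m < 2 * upperRoot (v + w) (v * w) m := by
  have := sqrt_pos.2 (upperRoot_disc_pos hw hvw hm)
  rw [upperRoot]
  linarith

/-- The discriminant is at least its value `(v - w)²` at `m = 0`, where the roots are `v` and `w`.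
-/
theorem le_upperRoot (hw : 0 ≤ w) (hvw : w < v) (hm : 0 ≤ m) :
    v ≤ upperRoot (v + w) (v * w) m := by
  have : v - w ≤ √((v + w + m) ^ 2 - 4 * (v * w)) := by
    apply le_sqrt_of_sq_le
    nlinarith [mul_nonneg hm (hw.trans hvw.le), mul_nonneg hm hw, mul_nonneg hm hm]
  rw [upperRoot]
  linarith

theorem upperRoot_mono (hw : 0 ≤ w) (hvw : w < v) {m' : ℝ} (hm : 0 ≤ m) (h : m ≤ m') :
    upperRoot (v + w) (v * w) m ≤ upperRoot (v + w) (v * w) m' := by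
  rw [upperRoot, upperRoot]
  have : 0 ≤ v + w + m := by linarith
  gcongr

end upperRoot

/-- The derivative is kept in the implicit form got by differentiating the quadratic; the factor `2U
- (s + m)` is the positive root of the discriminant. -/
theorem HasDerivAt.upperRoot {s c m : ℝ → ℝ} {s' c' m' t : ℝ} (hs : HasDerivAt s s' t)
    (hc : HasDerivAt c c' t) (hm : HasDerivAt m m' t) (h0 : 0 < (s t + m t) ^ 2 - 4 * c t) :
    ∃ U', HasDerivAt (fun t => upperRoot (s t) (c t) (m t)) U' t ∧
      (2 * upperRoot (s t) (c t) (m t) - (s t + m t)) * U' =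
        (s' + m') * upperRoot (s t) (c t) (m t) - c' := by
  have h1 := (((hs.add hm).pow 2).sub (hc.const_mul 4)).sqrt h0.ne'
  have h2 := ((hs.add hm).add h1).div_const 2
  refine ⟨_, h2, ?_⟩
  have h3 := sqrt_pos.2 h0
  simp only [_root_.upperRoot, Pi.add_apply, Pi.sub_apply, Pi.pow_apply]
  field_simp
  ring_nf

/-! ### Comparison with the extremal solution -/

/-- With `w = 1 - T` and `B = y - (T + y)w`, the numbers `w² q - B` and `w²(1 - q)` have a sum
independent of `q`, so their product is at most `(w² - B)²/4`. Since `e^y - 1 = y/T`, dividing by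
`w²` gives the hypothesised quotient. -/
theorem bound_le_of_sq_div_le {y T d : ℝ} (hT1 : T < 1) (hy : exp y - 1 = y / T) (hT : 0 < T)
    (hy0 : 0 < y)
    (h : (y * (1 + y) - (exp y - 1)) ^ 2 / (4 * (exp y - 1 - y) ^ 2) ≤ d) {q : ℝ} :
    (1 - q) * ((1 - T) ^ 2 * q - (y - (T + y) * (1 - T))) ≤ d := by
  refine le_trans ?_ h
  have h1 : 0 < 1 - T := by linarith
  have e : (y * (1 + y) - (exp y - 1)) ^ 2 / (4 * (exp y - 1 - y) ^ 2) =
      ((1 - T) ^ 2 - (y - (T + y) * (1 - T))) ^ 2 / (4 * (1 - T) ^ 2) := by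
    rw [hy]
    have h2 : y / T - y = y * (1 - T) / T := by field_simp
    rw [h2]
    field_simp
    ring
  rw [e, le_div_iff₀ (by positivity)]
  nlinarith [sq_nonneg ((1 - T) ^ 2 * q - (y - (T + y) * (1 - T)) - (1 - T) ^ 2 * (1 - q))]

/-- In the notation `w = 1 - T`, `B = y - (T + y)w`, one has `w² - B = 1 - (1 + y)T`, which is
nonpositive here; hence `w² q ≤ w² ≤ B`. -/
theorem bound_nonpos_of_exp_sub_one_le {y T : ℝ} (hy : exp y - 1 = y / T)
    (hT : 0 < T) (hy0 : 0 < y) (h : exp y - 1 ≤ y * (1 + y)) {q : ℝ} (hq : q ≤ 1) :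
    (1 - q) * ((1 - T) ^ 2 * q - (y - (T + y) * (1 - T))) ≤ 0 := by
  rw [hy, div_le_iff₀ hT] at h
  have h1 : 1 ≤ (1 + y) * T := by nlinarith
  apply mul_nonpos_of_nonneg_of_nonpos (by linarith)
  nlinarith [sq_nonneg (1 - T)]

/-- The comparison theorem behind the logarithmic convexity of Gaussian means: `N` is the
logarithm of the circular mean, `m` its derivative, `h` the area integral, all as functions of
`t = ln x`. -/
theorem convexOn_log_sub_log {a y₀ : ℝ} {N m h : ℝ → ℝ} (ha : 0 < a)
    (hy₀ : exp y₀ - 1 = y₀ * (1 + y₀)) (hpos : ∀ t, 0 < h t)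
    (hderiv : ∀ t, HasDerivAt h (exp (t + a * exp t + N t)) t)
    (hle : ∀ t, h t * a ≤ exp (N t) * (exp (a * exp t) - 1))
    (hN : Continuous N) (hNmono : Monotone N) (hm : Monotone m) (hm0 : ∀ t, 0 ≤ m t)
    (hgood : ∀ s, ∀ᶠ t in 𝓝[≠] s, HasDerivAt N (m t) t ∧ ∃ d, 0 ≤ d ∧ HasDerivAt m d t ∧
      (y₀ ≤ a * exp t → (a * exp t * (1 + a * exp t) - (exp (a * exp t) - 1)) ^ 2 /
        (4 * (exp (a * exp t) - 1 - a * exp t) ^ 2) ≤ d)) :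
    ConvexOn ℝ univ fun t => log (h t) - log (exp (a * exp t) - 1) := by
  set T : ℝ → ℝ := fun t => bernoulliQuot (a * exp t) with hTdef
  have hy : ∀ t, 0 < a * exp t := fun t => by positivity
  have hT0 : ∀ t, 0 < T t := fun t => bernoulliQuot_pos (hy t)
  have hT1 : ∀ t, T t < 1 := fun t => bernoulliQuot_lt_one (hy t)
  have hw : ∀ t, 0 ≤ 1 - T t := fun t => by linarith [hT1 t]
  have hvw : ∀ t, 1 - T t < T t + a * exp t := fun t => by
    linarith [one_lt_two_mul_bernoulliQuot_add (hy t)]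
  have hT' : ∀ t, HasDerivAt T (T t * (1 - T t - a * exp t)) t := hasDerivAt_bernoulliQuot_exp ha
  have hexpT : ∀ t, exp (a * exp t) - 1 = a * exp t / T t := fun t => by
    simp only [hTdef, bernoulliQuot]
    field_simp [(hy t).ne', (exp_sub_one_pos (hy t)).ne']
  have hyd : ∀ t, HasDerivAt (fun t => a * exp t) (a * exp t) t :=
    fun t => (hasDerivAt_exp t).const_mul a
  have hTc : Continuous T := continuous_iff_continuousAt.2 fun t => (hT' t).continuousAt
  set v : ℝ → ℝ := fun t => T t + a * exp t with hvdef
  set w : ℝ → ℝ := fun t => 1 - T t with hwdef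
  have hv' : ∀ t, HasDerivAt v (v t * w t) t := fun t =>
    ((hT' t).add (hyd t)).congr_deriv (by simp only [hvdef, hwdef]; ring)
  have hw' : ∀ t, HasDerivAt w (a * exp t - v t * w t) t := fun t =>
    ((hT' t).const_sub 1).congr_deriv (by simp only [hvdef, hwdef]; ring)
  have hvc : Continuous v := by fun_prop
  have hwc : Continuous w := by fun_prop
  have hv1 : ∀ t, 1 ≤ v t := fun t => one_le_bernoulliQuot_add (hy t)
  set U : ℝ → ℝ → ℝ := fun t μ => upperRoot (v t + w t) (v t * w t) μ with hUdef
  have hUv : ∀ t μ, 0 ≤ μ → v t ≤ U t μ := fun t μ h => le_upperRoot (hw t) (hvw t) h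
  have hU1 : ∀ t μ, 0 ≤ μ → 1 ≤ U t μ := fun t μ h => (hv1 t).trans (hUv t μ h)
  have hUc : ∀ μ, Continuous fun t => U t μ := fun μ => by
    simp only [hUdef, upperRoot]
    fun_prop
  set E : ℝ → ℝ := fun t => exp (t + a * exp t + N t) with hEdef
  have hE0 : ∀ t, 0 < E t := fun t => exp_pos _
  have hEc : Continuous E := by fun_prop
  have hhc : Continuous h := continuous_iff_continuousAt.2 fun t => (hderiv t).continuousAt
  have hE' : ∀ t, HasDerivAt N (m t) t → HasDerivAt E (E t * (v t + w t + m t)) t := by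
    intro t hNt
    refine (((hasDerivAt_id t).add (hyd t)).add hNt).exp.congr_deriv ?_
    simp only [hEdef, hvdef, hwdef, Pi.add_apply, id]
    ring
  have hG : Monotone fun t => h t - E t / U t (m t) := by
    refine monotone_of_eventually_hasDerivAt_nonneg (Φ := fun t μ => h t - E t / U t μ)
      (fun μ hμ => ?_) (fun t => ?_) hm hm0 fun s => ?_
    · exact hhc.sub (hEc.div₀ (hUc μ) fun t => (zero_lt_one.trans_le (hU1 t μ hμ)).ne')
    · intro μ hμ μ' hμ' hle
      have h1 : U t μ ≤ U t μ' := upperRoot_mono (hw t) (hvw t) hμ hle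
      have h2 := hU1 t μ hμ
      have h3 := hE0 t
      simp only
      gcongr
    · filter_upwards [hgood s] with t ⟨hNt, d, hd0, hmd, hB⟩
      have hdisc := upperRoot_disc_pos (hw t) (hvw t) (hm0 t)
      have hq : U t (m t) ^ 2 - (v t + w t + m t) * U t (m t) + v t * w t = 0 :=
        upperRoot_quadratic (hw t) (hvw t) (hm0 t)
      have h2U : v t + w t + m t < 2 * U t (m t) := lt_two_mul_upperRoot (hw t) (hvw t) (hm0 t)
      obtain ⟨U', hU', hUeq⟩ := ((hv' t).add (hw' t)).upperRoot ((hv' t).mul (hw' t)) hmd hdisc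
      have hUm := hU1 t (m t) (hm0 t)
      have hvU := hUv t (m t) (hm0 t)
      have hUne : U t (m t) ≠ 0 := (zero_lt_one.trans_le hUm).ne'
      refine ⟨_, ?_, (hderiv t).sub ((hE' t hNt).div hU' hUne)⟩
      -- Here `q = v/U`. Beyond `y₀` the growth hypothesis applies; below it the left side is
      -- nonpositive.
      have hkey : (1 - v t / U t (m t)) *
          (w t ^ 2 * (v t / U t (m t)) - (a * exp t - v t * w t)) ≤ d := by
        rcases le_or_gt y₀ (a * exp t) with hc | hc
        · exact bound_le_of_sq_div_le (hT1 t) (hexpT t) (hT0 t) (hy t) (hB hc)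
        · exact (bound_nonpos_of_exp_sub_one_le (hexpT t) (hT0 t) (hy t)
            (exp_sub_one_le_of_le (hy t) hc.le hy₀)
            (by rw [div_le_one (by linarith)]; exact hvU)).trans hd0
      change 0 ≤ E t - (E t * (v t + w t + m t) * U t (m t) - E t * U') / U t (m t) ^ 2
      change (2 * U t (m t) - (v t + w t + m t)) * U' =
        (v t * w t + (a * exp t - v t * w t) + d) * U t (m t) -
          (v t * w t * w t + v t * (a * exp t - v t * w t)) at hUeq
      generalize U t (m t) = u at *
      generalize v t = v at *
      generalize w t = w at *
      have hu : 0 < u := by linarith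
      have hkey' : (u - v) * (w ^ 2 * v - (a * exp t - v * w) * u) ≤ d * u ^ 2 := by
        have := mul_le_mul_of_nonneg_right hkey (sq_nonneg u)
        refine le_trans (le_of_eq ?_) this
        field_simp
      -- Multiplied by the positive factor `u(2u - (v + w + m))`, the difference `U' - vw` becomes
      -- exactly the slack in `hkey'`.
      have hfin : v * w ≤ U' := by
        have h3 : 0 ≤ u * ((2 * u - (v + w + m t)) * (U' - v * w)) := by
          have : u * ((2 * u - (v + w + m t)) * (U' - v * w)) =
              d * u ^ 2 - (u - v) * (w ^ 2 * v - (a * exp t - v * w) * u) := by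
            linear_combination u * hUeq - (v * w) * hq
          rw [this]
          linarith
        by_contra hlt
        push Not at hlt
        have : u * ((2 * u - (v + w + m t)) * (U' - v * w)) < 0 :=
          mul_neg_of_pos_of_neg hu (mul_neg_of_pos_of_neg (by linarith) (by linarith))
        linarith
      have : E t - (E t * (v + w + m t) * u - E t * U') / u ^ 2 = E t * (U' - v * w) / u ^ 2 := by
        field_simp
        linear_combination E t * hq
      rw [this]
      have := hE0 t
      have : 0 ≤ U' - v * w := by linarith
      positivity
  have hG0 : ∀ t, 0 ≤ h t - E t / U t (m t) := by
    intro t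
    -- Since `h > 0` and `U ≥ 1`, the function is at least `-E`, and `E → 0` at `-∞` because `N` is
    -- bounded above to the left of `t`.
    have hlim : Tendsto (fun s => -E s) atBot (𝓝 0) := by
      have hb : Tendsto (fun s => exp (s + (a * exp t + N t))) atBot (𝓝 0) :=
        tendsto_exp_atBot.comp (tendsto_atBot_add_const_right _ _ tendsto_id)
      have : Tendsto E atBot (𝓝 0) := by
        refine squeeze_zero' (Eventually.of_forall fun s => (hE0 s).le) ?_ hb
        filter_upwards [eventually_le_atBot t] with s hs
        have := hNmono hs
        simp only [hEdef]
        rw [add_assoc]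
        gcongr
      simpa using this.neg
    refine le_of_tendsto hlim ?_
    filter_upwards [eventually_le_atBot t] with s hs
    refine le_trans ?_ (hG hs)
    have h1 : E s / U s (m s) ≤ E s := div_le_self (hE0 s).le (hU1 s _ (hm0 s))
    have h2 := hpos s
    simp only
    linarith
  have hL : ∀ t, HasDerivAt (fun t => log (h t) - log (exp (a * exp t) - 1)) (E t / h t - v t) t :=
    fun t => ((hderiv t).log (hpos t).ne').sub (hasDerivAt_log_exp_sub_one ha t)
  refine Monotone.convexOn_univ_of_deriv (fun t => (hL t).differentiableAt) ?_
  have hdL : deriv (fun t => log (h t) - log (exp (a * exp t) - 1)) = fun t => E t / h t - v t :=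
    funext fun t => (hL t).deriv
  rw [hdL]
  -- Now `Φ` ignores its second variable: `E/h - v` is continuous, so the exceptional points cause
  -- no jump.
  refine monotone_of_eventually_hasDerivAt_nonneg (Φ := fun t _ => E t / h t - v t) (m := m)
      (fun μ hμ => (hEc.div₀ hhc fun t => (hpos t).ne').sub hvc)
      (fun t => monotoneOn_const) hm hm0 fun s => ?_
  filter_upwards [hgood s] with t ⟨hNt, _⟩
  refine ⟨_, ?_, ((hE' t hNt).div (hderiv t) (hpos t).ne').sub (hv' t)⟩
  have hq : U t (m t) ^ 2 - (v t + w t + m t) * U t (m t) + v t * w t = 0 :=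
    upperRoot_quadratic (hw t) (hvw t) (hm0 t)
  have hh := hpos t
  have h1 : E t / h t ≤ U t (m t) := by
    have := hG0 t
    rw [div_le_iff₀ hh]
    rw [sub_nonneg, div_le_iff₀ (by linarith [hU1 t (m t) (hm0 t)])] at this
    linarith
  have h2 : v t ≤ E t / h t := by
    rw [le_div_iff₀ hh]
    have h3 := hle t
    have h4 : v t * (exp (a * exp t) - 1) = a * exp t * exp (a * exp t) := by
      have h5 : T t * (exp (a * exp t) - 1) = a * exp t := by
        rw [hexpT t]
        field_simp [(hT0 t).ne']
      simp only [hvdef]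
      linear_combination h5
    have h6 : E t = exp t * exp (a * exp t) * exp (N t) := by
      simp only [hEdef, exp_add]
    have h7 : v t * h t * a ≤ E t * a := by
      have := mul_le_mul_of_nonneg_left h3 (zero_le_one.trans (hv1 t))
      rw [h6]
      calc v t * h t * a = v t * (h t * a) := by ring
        _ ≤ v t * (exp (N t) * (exp (a * exp t) - 1)) := this
        _ = exp (N t) * (v t * (exp (a * exp t) - 1)) := by ring
        _ = _ := by rw [h4]; ring
    exact le_of_mul_le_mul_right h7 ha
  have h3 : (E t * (v t + w t + m t) * h t - E t * E t) / h t ^ 2 =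
      E t / h t * (v t + w t + m t - E t / h t) := by
    field_simp
  change 0 ≤ (E t * (v t + w t + m t) * h t - E t * E t) / h t ^ 2 - v t * w t
  rw [h3]
  have hm' := hm0 t
  have hv1' := hv1 t
  have h2U := hU1 t (m t) hm'
  have h2U' : v t + w t + m t < 2 * U t (m t) := lt_two_mul_upperRoot (hw t) (hvw t) (hm0 t)
  generalize E t / h t = u at *
  -- The lower root is `v + w + m - U`. If `u` lay below it, so would `v`, and the quadratic would
  -- be positive at `v`, where it equals `-mv`.
  have hlow : 0 ≤ u + U t (m t) - (v t + w t + m t) := by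
    by_contra hneg
    push Not at hneg
    nlinarith [mul_nonneg hm' (by linarith : (0:ℝ) ≤ v t)]
  nlinarith [mul_nonneg (sub_nonneg.2 h1) hlow]

/-! ### Circular means of regularised powers -/

/-- Differentiation under the integral sign for continuous integrands on a strip. -/
theorem hasDerivAt_intervalIntegral_of_continuousOn {F F' : ℝ → ℝ → ℝ} {I : Set ℝ} {a b s : ℝ}
    (hI : IsOpen I) (hF : ContinuousOn (Function.uncurry F) (I ×ˢ univ))
    (hF' : ContinuousOn (Function.uncurry F') (I ×ˢ univ))
    (hd : ∀ s ∈ I, ∀ θ, HasDerivAt (fun s => F s θ) (F' s θ) s) (hs : s ∈ I) :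
    HasDerivAt (fun s => ∫ θ in a..b, F s θ) (∫ θ in a..b, F' s θ) s := by
  have slice : ∀ {H : ℝ → ℝ → ℝ}, ContinuousOn (Function.uncurry H) (I ×ˢ univ) →
      ∀ s ∈ I, Continuous (H s) := by
    intro H hH s hs
    rw [← continuousOn_univ]
    exact hH.comp (f := fun θ => (s, θ)) (by fun_prop) fun θ _ => ⟨hs, trivial⟩
  obtain ⟨δ, hδ, hball⟩ := Metric.nhds_basis_closedBall.mem_iff.1 (hI.mem_nhds hs)
  obtain ⟨C, hC⟩ := ((isCompact_closedBall s δ).prod (isCompact_uIcc (a := a) (b := b))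
    ).exists_bound_of_continuousOn (hF'.mono (prod_mono hball (subset_univ _)))
  refine (intervalIntegral.hasDerivAt_integral_of_dominated_loc_of_deriv_le
    (bound := fun _ => C) (F' := F') (Metric.closedBall_mem_nhds s hδ) ?_ ?_ ?_ ?_ ?_ ?_).2
  · filter_upwards [hI.mem_nhds hs] with x hx
    exact (slice hF x hx).aestronglyMeasurable
  · exact (slice hF s hs).intervalIntegrable _ _
  · exact (slice hF' s hs).aestronglyMeasurable
  · exact Eventually.of_forall fun θ hθ x hx => hC (x, θ) ⟨hx, uIoc_subset_uIcc hθ⟩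
  · exact continuous_const.intervalIntegrable _ _
  · exact Eventually.of_forall fun θ _ x hx => hd x (hball hx) θ

section regPow

open scoped RealInnerProductSpace

/-- The regularised power `(‖z‖² + ε)^b`. -/
noncomputable def regPow (b ε : ℝ) (z : ℂ) : ℝ := (‖z‖ ^ 2 + ε) ^ b

/-- First derivative of `regPow b ε` along a curve with velocity `z₁`. -/
noncomputable def regPowDeriv (b ε : ℝ) (z z₁ : ℂ) : ℝ :=
  2 * ⟪z, z₁⟫ * b * (‖z‖ ^ 2 + ε) ^ (b - 1)

/-- Second derivative of `regPow b ε` along a curve with velocity `z₁` and acceleration `z₂`. -/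
noncomputable def regPowDeriv2 (b ε : ℝ) (z z₁ z₂ : ℂ) : ℝ :=
  2 * (⟪z, z₂⟫ + ⟪z₁, z₁⟫) * b * (‖z‖ ^ 2 + ε) ^ (b - 1) +
    2 * ⟪z, z₁⟫ * b * (2 * ⟪z, z₁⟫ * (b - 1) * (‖z‖ ^ 2 + ε) ^ (b - 1 - 1))

variable {b ε t : ℝ} {γ γ₁ : ℝ → ℂ} {z₁ z₂ : ℂ}

theorem HasDerivAt.regPow (h : HasDerivAt γ z₁ t) (hQ : 0 < ‖γ t‖ ^ 2 + ε) :
    HasDerivAt (fun t => regPow b ε (γ t)) (regPowDeriv b ε (γ t) z₁) t :=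
  (h.norm_sq.add_const ε).rpow_const (Or.inl hQ.ne')

theorem HasDerivAt.regPowDeriv (h : HasDerivAt γ (γ₁ t) t) (h₁ : HasDerivAt γ₁ z₂ t)
    (hQ : 0 < ‖γ t‖ ^ 2 + ε) :
    HasDerivAt (fun t => regPowDeriv b ε (γ t) (γ₁ t)) (regPowDeriv2 b ε (γ t) (γ₁ t) z₂) t :=
  (((h.inner ℝ h₁).const_mul 2).mul_const b).mul
    ((h.norm_sq.add_const ε).rpow_const (Or.inl hQ.ne'))

/-- Log-subharmonicity of the regularised modulus of a holomorphic function. -/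
theorem regPowDeriv2_add_nonneg (hb : 0 ≤ b) (hε : 0 ≤ ε) {z : ℂ} (hQ : 0 < ‖z‖ ^ 2 + ε)
    (c : ℝ) : 0 ≤ regPowDeriv2 b ε z z₁ z₂ +
      regPowDeriv2 b ε z (Complex.I * z₁) (-z₂) + 2 * c * regPowDeriv b ε z z₁ +
      c ^ 2 * regPow b ε z := by
  have h1 : (‖z‖ ^ 2 + ε) ^ (b - 1) = (‖z‖ ^ 2 + ε) ^ (b - 1 - 1) * (‖z‖ ^ 2 + ε) := by
    rw [← rpow_add_one hQ.ne']; congr 1; ring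
  have h0 : (‖z‖ ^ 2 + ε) ^ b = (‖z‖ ^ 2 + ε) ^ (b - 1 - 1) * (‖z‖ ^ 2 + ε) ^ 2 := by
    rw [pow_two (_ + ε), ← mul_assoc, ← h1, ← rpow_add_one hQ.ne', sub_add_cancel]
  rw [regPow, regPowDeriv, regPowDeriv2, regPowDeriv2, h1, h0]
  have hP : 0 < (‖z‖ ^ 2 + ε) ^ (b - 1 - 1) := rpow_pos_of_pos hQ _
  generalize (‖z‖ ^ 2 + ε) ^ (b - 1 - 1) = P at *
  have hn : ‖z‖ ^ 2 = z.re ^ 2 + z.im ^ 2 := by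
    rw [← Complex.normSq_eq_norm_sq, Complex.normSq_apply]; ring
  simp only [Complex.inner, hn, Complex.mul_re, Complex.mul_im, Complex.conj_re,
    Complex.conj_im, Complex.neg_re, Complex.neg_im, Complex.I_re, Complex.I_im]
  generalize z.re = x
  generalize z.im = y
  generalize z₁.re = p
  generalize z₁.im = q
  -- The expression is `e^{-cs}` times the Laplacian of `e^{cs}(|G|² + ε)^b`. The terms in `z₂`
  -- cancel by holomorphy and a sum of squares remains.
  have key : 0 ≤ P * ((2 * b * (x * p + y * q) + c * (x ^ 2 + y ^ 2 + ε)) ^ 2 +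
      4 * b ^ 2 * (x * q - y * p) ^ 2 + 4 * b * ε * (p ^ 2 + q ^ 2)) := by positivity
  refine key.trans_eq ?_
  ring

variable {X : Type*} [TopologicalSpace X] {A : Set X} {f f₁ f₂ : X → ℂ}

theorem ContinuousOn.regPow (hf : ContinuousOn f A) (hQ : ∀ x ∈ A, 0 < ‖f x‖ ^ 2 + ε) :
    ContinuousOn (fun x => regPow b ε (f x)) A :=
  ((hf.norm.pow 2).add continuousOn_const).rpow_const fun x hx => Or.inl (hQ x hx).ne'

theorem ContinuousOn.regPowDeriv (hf : ContinuousOn f A) (hf₁ : ContinuousOn f₁ A)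
    (hQ : ∀ x ∈ A, 0 < ‖f x‖ ^ 2 + ε) :
    ContinuousOn (fun x => regPowDeriv b ε (f x) (f₁ x)) A :=
  ((continuousOn_const.mul (hf.inner hf₁)).mul continuousOn_const).mul
    (((hf.norm.pow 2).add continuousOn_const).rpow_const fun x hx => Or.inl (hQ x hx).ne')

theorem ContinuousOn.regPowDeriv2 (hf : ContinuousOn f A) (hf₁ : ContinuousOn f₁ A)
    (hf₂ : ContinuousOn f₂ A) (hQ : ∀ x ∈ A, 0 < ‖f x‖ ^ 2 + ε) :
    ContinuousOn (fun x => regPowDeriv2 b ε (f x) (f₁ x) (f₂ x)) A := by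
  have h1 : ∀ e : ℝ, ContinuousOn (fun x => (‖f x‖ ^ 2 + ε) ^ e) A := fun e =>
    ((hf.norm.pow 2).add continuousOn_const).rpow_const fun x hx => Or.inl (hQ x hx).ne'
  have h2 := hf.inner (𝕜 := ℝ) hf₂
  have h3 := hf₁.inner (𝕜 := ℝ) hf₁
  have h4 := hf.inner (𝕜 := ℝ) hf₁
  have h5 := h1 (b - 1)
  have h6 := h1 (b - 1 - 1)
  unfold _root_.regPowDeriv2
  fun_prop

end regPow

/-- The circular mean of the regularised power of `G ∘ exp⁻¹`, on the circle of radius `e^s`,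
written for a `2πi`-periodic function `G`. -/
noncomputable def regMean (b ε : ℝ) (G : ℂ → ℂ) (s : ℝ) : ℝ :=
  ∫ θ in (0 : ℝ)..(2 * π), regPow b ε (G (s + θ * Complex.I))

theorem hasDerivAt_horizontal {G : ℂ → ℂ} (hG : Differentiable ℂ G) (s θ : ℝ) :
    HasDerivAt (fun s : ℝ => G (s + θ * Complex.I)) (deriv G (s + θ * Complex.I)) s := by
  have h : HasDerivAt (fun w : ℂ => w + θ * Complex.I) 1 (s : ℂ) :=
    (hasDerivAt_id _).add_const _
  simpa using! ((hG _).hasDerivAt.comp (s : ℂ) h).comp_ofReal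

theorem hasDerivAt_vertical {G : ℂ → ℂ} (hG : Differentiable ℂ G) (s θ : ℝ) :
    HasDerivAt (fun θ : ℝ => G (s + θ * Complex.I))
      (Complex.I * deriv G (s + θ * Complex.I)) θ := by
  have h : HasDerivAt (fun w : ℂ => (s : ℂ) + w * Complex.I) Complex.I (θ : ℂ) := by
    simpa using ((hasDerivAt_id (θ : ℂ)).mul_const Complex.I).const_add (s : ℂ)
  have := ((hG _).hasDerivAt.comp (θ : ℂ) h).comp_ofReal
  rw [mul_comm]
  exact this

section regMean

variable {b ε : ℝ} {G : ℂ → ℂ} {I : Set ℝ}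

/-- By periodicity the second `θ`-derivative integrates to zero, so `K₂` is the integral of a
Laplacian. The inequality for all `c` says that every `e^{cs}` times the mean is convex. The value
`ε = 0` is allowed where `G` has no zeros. -/
theorem regMean_derivatives (hb : 0 ≤ b) (hε : 0 ≤ ε) (hG : Differentiable ℂ G)
    (hper : ∀ w, G (w + 2 * π * Complex.I) = G w) (hI : IsOpen I)
    (hQ : ∀ s ∈ I, ∀ θ : ℝ, 0 < ‖G (s + θ * Complex.I)‖ ^ 2 + ε) :
    ∃ K₁ K₂ : ℝ → ℝ, ∀ s ∈ I, HasDerivAt (regMean b ε G) (K₁ s) s ∧ HasDerivAt K₁ (K₂ s) s ∧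
      ∀ c : ℝ, 0 ≤ K₂ s + 2 * c * K₁ s + c ^ 2 * regMean b ε G s := by
  have hG1 : Differentiable ℂ (deriv G) := hG.deriv
  have hG2 : Differentiable ℂ (deriv (deriv G)) := hG1.deriv
  have hcurve : Continuous fun q : ℝ × ℝ => ((q.1 : ℂ) + q.2 * Complex.I) := by fun_prop
  have hc0 : Continuous fun q : ℝ × ℝ => G (q.1 + q.2 * Complex.I) := hG.continuous.comp hcurve
  have hc1 : Continuous fun q : ℝ × ℝ => deriv G (q.1 + q.2 * Complex.I) :=
    hG1.continuous.comp hcurve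
  have hc2 : Continuous fun q : ℝ × ℝ => deriv (deriv G) (q.1 + q.2 * Complex.I) :=
    hG2.continuous.comp hcurve
  have hQ' : ∀ q ∈ I ×ˢ (univ : Set ℝ), 0 < ‖G ((q : ℝ × ℝ).1 + q.2 * Complex.I)‖ ^ 2 + ε :=
    fun q hq => hQ _ hq.1 _
  have hF0 : ContinuousOn (Function.uncurry fun s θ : ℝ => regPow b ε (G (s + θ * Complex.I)))
      (I ×ˢ univ) := hc0.continuousOn.regPow hQ'
  have hF1 : ContinuousOn (Function.uncurry fun s θ : ℝ =>
      regPowDeriv b ε (G (s + θ * Complex.I)) (deriv G (s + θ * Complex.I)))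
      (I ×ˢ univ) := hc0.continuousOn.regPowDeriv hc1.continuousOn hQ'
  have hF2 : ContinuousOn (Function.uncurry fun s θ : ℝ =>
      regPowDeriv2 b ε (G (s + θ * Complex.I)) (deriv G (s + θ * Complex.I))
        (deriv (deriv G) (s + θ * Complex.I)))
      (I ×ˢ univ) := hc0.continuousOn.regPowDeriv2 hc1.continuousOn hc2.continuousOn hQ'
  refine ⟨fun s => ∫ θ in (0 : ℝ)..(2 * π),
    regPowDeriv b ε (G (s + θ * Complex.I)) (deriv G (s + θ * Complex.I)),
    fun s => ∫ θ in (0 : ℝ)..(2 * π),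
    regPowDeriv2 b ε (G (s + θ * Complex.I)) (deriv G (s + θ * Complex.I))
      (deriv (deriv G) (s + θ * Complex.I)), fun s hs => ⟨?_, ?_, fun c => ?_⟩⟩
  · exact hasDerivAt_intervalIntegral_of_continuousOn hI hF0 hF1
      (fun s hs θ => (hasDerivAt_horizontal hG s θ).regPow (hQ s hs θ)) hs
  · exact hasDerivAt_intervalIntegral_of_continuousOn hI hF1 hF2
      (fun s hs θ => HasDerivAt.regPowDeriv (γ₁ := fun s : ℝ => deriv G (s + θ * Complex.I))
        (hasDerivAt_horizontal hG s θ) (hasDerivAt_horizontal hG1 s θ) (hQ s hs θ)) hs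
  · have slice : ∀ {H : ℝ → ℝ → ℝ}, ContinuousOn (Function.uncurry H) (I ×ˢ univ) →
        Continuous (H s) := by
      intro H hH
      rw [← continuousOn_univ]
      exact hH.comp (f := fun θ => (s, θ)) (by fun_prop) fun θ _ => ⟨hs, trivial⟩
    have hvert : ∀ θ : ℝ, HasDerivAt (fun θ : ℝ => regPowDeriv b ε (G (s + θ * Complex.I))
        (Complex.I * deriv G (s + θ * Complex.I)))
        (regPowDeriv2 b ε (G (s + θ * Complex.I)) (Complex.I * deriv G (s + θ * Complex.I))
          (-deriv (deriv G) (s + θ * Complex.I))) θ := by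
      intro θ
      refine HasDerivAt.regPowDeriv
        (γ₁ := fun θ : ℝ => Complex.I * deriv G (s + θ * Complex.I))
        (hasDerivAt_vertical hG s θ) ?_ (hQ s hs θ)
      refine ((hasDerivAt_vertical hG1 s θ).const_mul Complex.I).congr_deriv ?_
      rw [← mul_assoc, Complex.I_mul_I, neg_one_mul]
    have hline : Continuous fun θ : ℝ => ((s : ℂ) + θ * Complex.I) := by fun_prop
    have hvc : Continuous fun θ : ℝ => regPowDeriv2 b ε (G (s + θ * Complex.I))
        (Complex.I * deriv G (s + θ * Complex.I)) (-deriv (deriv G) (s + θ * Complex.I)) := by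
      rw [← continuousOn_univ]
      exact (hG.continuous.comp hline).continuousOn.regPowDeriv2
        (continuous_const.mul (hG1.continuous.comp hline)).continuousOn
        (hG2.continuous.comp hline).neg.continuousOn fun θ _ => hQ s hs θ
    have hper1 : ∀ w, deriv G (w + 2 * π * Complex.I) = deriv G w := by
      intro w
      rw [← deriv_comp_add_const]
      congr 1
      exact funext hper
    have hzero : ∫ θ in (0 : ℝ)..(2 * π), regPowDeriv2 b ε (G (s + θ * Complex.I))
        (Complex.I * deriv G (s + θ * Complex.I)) (-deriv (deriv G) (s + θ * Complex.I)) = 0 := by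
      rw [intervalIntegral.integral_eq_sub_of_hasDerivAt (fun θ _ => hvert θ)
        (hvc.intervalIntegrable _ _)]
      push_cast
      rw [hper, hper1]
      simp
    have hi0 := (slice hF0).intervalIntegrable (μ := volume) 0 (2 * π)
    have hi1 := (slice hF1).intervalIntegrable (μ := volume) 0 (2 * π)
    have hi2 := (slice hF2).intervalIntegrable (μ := volume) 0 (2 * π)
    have hi3 := hvc.intervalIntegrable (μ := volume) 0 (2 * π)
    have hnn : 0 ≤ ∫ θ in (0 : ℝ)..(2 * π),
        (regPowDeriv2 b ε (G (s + θ * Complex.I)) (deriv G (s + θ * Complex.I))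
          (deriv (deriv G) (s + θ * Complex.I)) +
        regPowDeriv2 b ε (G (s + θ * Complex.I))
          (Complex.I * deriv G (s + θ * Complex.I)) (-deriv (deriv G) (s + θ * Complex.I)) +
        2 * c * regPowDeriv b ε (G (s + θ * Complex.I)) (deriv G (s + θ * Complex.I)) +
        c ^ 2 * regPow b ε (G (s + θ * Complex.I))) :=
      intervalIntegral.integral_nonneg two_pi_pos.le fun θ _ =>
        regPowDeriv2_add_nonneg hb hε (hQ s hs θ) c
    rw [intervalIntegral.integral_add ((hi2.add hi3).add (hi1.const_mul _)) (hi0.const_mul _),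
      intervalIntegral.integral_add (hi2.add hi3) (hi1.const_mul _),
      intervalIntegral.integral_add hi2 hi3, hzero, intervalIntegral.integral_const_mul,
      intervalIntegral.integral_const_mul, add_zero] at hnn
    exact hnn

theorem log_regMean_derivatives (hb : 0 ≤ b) (hε : 0 ≤ ε) (hG : Differentiable ℂ G)
    (hper : ∀ w, G (w + 2 * π * Complex.I) = G w) (hI : IsOpen I)
    (hQ : ∀ s ∈ I, ∀ θ : ℝ, 0 < ‖G (s + θ * Complex.I)‖ ^ 2 + ε) :
    ∃ L₁ L₂ : ℝ → ℝ, ∀ s ∈ I, HasDerivAt (fun s => log (regMean b ε G s)) (L₁ s) s ∧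
      HasDerivAt L₁ (L₂ s) s ∧ 0 ≤ L₂ s := by
  obtain ⟨K₁, K₂, hK⟩ := regMean_derivatives hb hε hG hper hI hQ
  refine ⟨fun s => K₁ s / regMean b ε G s,
    fun s => (K₂ s * regMean b ε G s - K₁ s * K₁ s) / regMean b ε G s ^ 2, fun s hs => ?_⟩
  obtain ⟨h1, h2, h3⟩ := hK s hs
  have hpos : 0 < regMean b ε G s := by
    have hcont : Continuous fun θ : ℝ => regPow b ε (G (s + θ * Complex.I)) := by
      rw [← continuousOn_univ]
      exact (hG.continuous.comp (by fun_prop)).continuousOn.regPow fun θ _ => hQ s hs θ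
    exact intervalIntegral.intervalIntegral_pos_of_pos_on (hcont.intervalIntegrable _ _)
      (fun θ _ => rpow_pos_of_pos (hQ s hs θ) _) two_pi_pos
  refine ⟨h1.log hpos.ne', h2.div h1 hpos.ne', div_nonneg ?_ (sq_nonneg _)⟩
  -- This `c` minimises the quadratic and yields the discriminant inequality `K₁² ≤ K₂ K`, with `K`
  -- the mean.
  have := mul_nonneg (h3 (-(K₁ s / regMean b ε G s))) hpos.le
  have e : (K₂ s + 2 * -(K₁ s / regMean b ε G s) * K₁ s +
      (-(K₁ s / regMean b ε G s)) ^ 2 * regMean b ε G s) * regMean b ε G s =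
      K₂ s * regMean b ε G s - K₁ s * K₁ s := by
    field_simp
    ring
  rwa [e] at this

/-- Hardy's convexity theorem for regularised means. -/
theorem convexOn_log_regMean_of_pos (hb : 0 ≤ b) (hε : 0 < ε) (hG : Differentiable ℂ G)
    (hper : ∀ w, G (w + 2 * π * Complex.I) = G w) :
    ConvexOn ℝ univ fun s => log (regMean b ε G s) := by
  obtain ⟨L₁, L₂, hL⟩ := log_regMean_derivatives hb hε.le hG hper isOpen_univ
    (fun s _ θ => by positivity)
  refine Monotone.convexOn_univ_of_deriv (fun s => (hL s trivial).1.differentiableAt) ?_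
  rw [show deriv (fun s => log (regMean b ε G s)) = L₁ from
    funext fun s => (hL s trivial).1.deriv]
  refine monotone_of_deriv_nonneg (fun s => (hL s trivial).2.1.differentiableAt) fun s => ?_
  rw [(hL s trivial).2.1.deriv]
  exact (hL s trivial).2.2

/-- Hardy's convexity theorem. -/
theorem convexOn_log_regMean_zero (hb : 0 < b) (hG : Differentiable ℂ G)
    (hper : ∀ w, G (w + 2 * π * Complex.I) = G w) (hpos : ∀ s, 0 < regMean b 0 G s) :
    ConvexOn ℝ univ fun s => log (regMean b 0 G s) := by
  have hlim : ∀ s, Tendsto (fun ε => log (regMean b ε G s)) (𝓝[>] 0)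
      (𝓝 (log (regMean b 0 G s))) := by
    intro s
    have hc : Continuous fun ε => regMean b ε G s := by
      unfold regMean
      refine intervalIntegral.continuous_parametric_intervalIntegral_of_continuous' ?_ _ _
      have : Continuous fun q : ℝ × ℝ => G (s + q.2 * Complex.I) :=
        hG.continuous.comp (by fun_prop)
      simp only [regPow, Function.uncurry_def]
      exact ((this.norm.pow 2).add continuous_fst).rpow_const fun _ => Or.inr hb.le
    exact ((hc.tendsto 0).log (hpos s).ne').mono_left nhdsWithin_le_nhds
  refine ⟨convex_univ, fun x _ y _ α β hα hβ hαβ => ?_⟩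
  refine le_of_tendsto_of_tendsto (hlim _)
    (((hlim x).const_smul α).add ((hlim y).const_smul β)) ?_
  filter_upwards [self_mem_nhdsWithin] with ε hε
  exact (convexOn_log_regMean_of_pos hb.le hε hG hper).2 trivial trivial hα hβ hαβ

end regMean

/-! ### Area integrals in polar coordinates -/

theorem setIntegral_closedBall_eq_polar {g : ℂ → ℝ} (hg : Continuous g) {r : ℝ} (hr : 0 ≤ r) :
    ∫ z in Metric.closedBall (0 : ℂ) r, g z =
      ∫ ρ in (0 : ℝ)..r, ρ * ∫ θ in (0 : ℝ)..(2 * π), g (ρ * Complex.exp (θ * Complex.I)) := by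
  have hperiod : ∀ ρ : ℝ, ∫ θ in (0 : ℝ)..(2 * π), g (ρ * Complex.exp (θ * Complex.I)) =
      ∫ θ in Ioo (-π) π, g (Complex.polarCoord.symm (ρ, θ)) := by
    intro ρ
    have hp : Function.Periodic (fun θ : ℝ => g (ρ * Complex.exp (θ * Complex.I))) (2 * π) := by
      intro θ
      simp only
      congr 2
      push_cast
      rw [add_mul, Complex.exp_add, Complex.exp_two_pi_mul_I, mul_one]
    have := hp.intervalIntegral_add_eq 0 (-π)
    rw [zero_add, show -π + 2 * π = π by ring] at this
    rw [this, intervalIntegral.integral_of_le (by linarith [pi_pos]),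
      integral_Ioc_eq_integral_Ioo]
    simp only [Complex.polarCoord_symm_apply, Complex.exp_mul_I, Complex.ofReal_cos,
      Complex.ofReal_sin]
  have hsymm : Continuous fun q : ℝ × ℝ => Complex.polarCoord.symm q := by
    simp only [Complex.polarCoord_symm_apply]
    fun_prop
  have hcont : Continuous fun q : ℝ × ℝ => q.1 * g (Complex.polarCoord.symm q) :=
    continuous_fst.mul (hg.comp hsymm)
  have hmeas : MeasurableSet (Iic r ×ˢ (univ : Set ℝ)) := measurableSet_Iic.prod MeasurableSet.univ
  have hset : Complex.polarCoord.target ∩ (Iic r ×ˢ (univ : Set ℝ)) = Ioc 0 r ×ˢ Ioo (-π) π := by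
    rw [Complex.polarCoord_target, prod_inter_prod, inter_univ, Ioi_inter_Iic]
  have hint : IntegrableOn (fun q : ℝ × ℝ => q.1 * g (Complex.polarCoord.symm q))
      (Ioc 0 r ×ˢ Ioo (-π) π) (volume.prod volume) :=
    (hcont.continuousOn.integrableOn_compact (isCompact_Icc.prod isCompact_Icc)).mono_set
      (prod_mono (Ioc_subset_Icc_self (a := 0) (b := r)) (Ioo_subset_Icc_self (a := -π) (b := π)))
  rw [← integral_indicator Metric.isClosed_closedBall.measurableSet,
    ← Complex.integral_comp_polarCoord_symm,
    show polarCoord.target = Complex.polarCoord.target by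
      rw [Complex.polarCoord_target, polarCoord_target]]
  have h1 : ∫ q in Complex.polarCoord.target,
      q.1 • (Metric.closedBall (0 : ℂ) r).indicator g (Complex.polarCoord.symm q) =
      ∫ q in Complex.polarCoord.target, (Iic r ×ˢ (univ : Set ℝ)).indicator
        (fun q => q.1 * g (Complex.polarCoord.symm q)) q := by
    refine setIntegral_congr_fun Complex.polarCoord.open_target.measurableSet fun q hq => ?_
    have hq0 : 0 < q.1 := by
      rw [Complex.polarCoord_target] at hq
      exact hq.1
    have hnorm : ‖Complex.polarCoord.symm q‖ = q.1 := by
      rw [Complex.norm_polarCoord_symm, abs_of_pos hq0]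
    by_cases h : q.1 ≤ r
    · rw [indicator_of_mem (mem_closedBall_zero_iff.2 (hnorm.le.trans h)), indicator_of_mem (by simpa using! h),
        smul_eq_mul]
    · rw [indicator_of_notMem fun h' => h (hnorm.ge.trans (mem_closedBall_zero_iff.1 h')), indicator_of_notMem (by simpa using! h),
        smul_zero]
  rw [h1, setIntegral_indicator hmeas, hset, Measure.volume_eq_prod, setIntegral_prod _ hint,
    intervalIntegral.integral_of_le hr]
  refine setIntegral_congr_fun measurableSet_Ioc fun ρ _ => ?_
  simp only
  rw [integral_const_mul, hperiod]

theorem continuous_norm_rpow_circle {p : ℝ} (hp : 0 < p) {f : ℂ → ℂ} (hf : Continuous f) :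
    Continuous fun ρ : ℝ => circleMean p f (ρ ^ 2) := by
  unfold circleMean
  simp only [sqrt_sq_eq_abs]
  refine intervalIntegral.continuous_parametric_intervalIntegral_of_continuous' ?_ _ _
  simp only [Function.uncurry_def]
  have h : Continuous fun q : ℝ × ℝ => f (((|q.1| : ℝ) : ℂ) * Complex.exp (q.2 * Complex.I)) :=
    hf.comp (by fun_prop)
  exact h.norm.rpow_const fun _ => Or.inr hp.le

/-- The numerator of the Gaussian mean. -/
theorem setIntegral_gaussian_eq {α p : ℝ} (hp : 0 < p) {f : ℂ → ℂ} (hf : Continuous f) {r : ℝ}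
    (hr : 0 ≤ r) :
    ∫ z in Metric.closedBall (0 : ℂ) r, ‖f z‖ ^ p * exp (-α * ‖z‖ ^ 2) =
      ∫ ρ in (0 : ℝ)..r, ρ * exp (-α * ρ ^ 2) * circleMean p f (ρ ^ 2) := by
  have hg : Continuous fun z : ℂ => ‖f z‖ ^ p * exp (-α * ‖z‖ ^ 2) :=
    (hf.norm.rpow_const fun _ => Or.inr hp.le).mul (by fun_prop)
  rw [setIntegral_closedBall_eq_polar hg hr]
  refine intervalIntegral.integral_congr fun ρ hρ => ?_
  rw [uIcc_of_le hr] at hρ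
  simp only [circleMean, sqrt_sq hρ.1, norm_mul, Complex.norm_exp_ofReal_mul_I, mul_one,
    Complex.norm_real, norm_eq_abs, sq_abs]
  rw [intervalIntegral.integral_mul_const]
  ring

theorem integral_mul_exp_sq {a : ℝ} (ha : a ≠ 0) (r : ℝ) :
    ∫ ρ in (0 : ℝ)..r, ρ * exp (a * ρ ^ 2) = (exp (a * r ^ 2) - 1) / (2 * a) := by
  have hd : ∀ ρ ∈ uIcc 0 r, HasDerivAt (fun ρ => exp (a * ρ ^ 2) / (2 * a))
      (ρ * exp (a * ρ ^ 2)) ρ := fun ρ _ => by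
    have := (((hasDerivAt_pow 2 ρ).const_mul a).exp).div_const (2 * a)
    refine this.congr_deriv ?_
    field_simp
    simp [mul_comm]
  rw [intervalIntegral.integral_eq_sub_of_hasDerivAt hd
    (Continuous.intervalIntegrable (by fun_prop) _ _)]
  simp
  ring

theorem setIntegral_exp_sq_eq {α : ℝ} (hα : α ≠ 0) {r : ℝ} (hr : 0 ≤ r) :
    ∫ z in Metric.closedBall (0 : ℂ) r, exp (-α * ‖z‖ ^ 2) =
      π / -α * (exp (-α * r ^ 2) - 1) := by
  have h := setIntegral_gaussian_eq (α := α) zero_lt_one (continuous_const (y := (1 : ℂ))) hr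
  simp only [norm_one, one_rpow, one_mul, circleMean, intervalIntegral.integral_const,
    sub_zero, smul_eq_mul, mul_one] at h
  rw [h, intervalIntegral.integral_mul_const, integral_mul_exp_sq (neg_ne_zero.2 hα)]
  field_simp

/-! ### Zeros of entire functions on circles -/

/-- Vanishing on a circle forces vanishing on the disc by the maximum principle, then everywhere by
the identity theorem. -/
theorem exists_ne_zero_on_circle {f : ℂ → ℂ} (hf : Differentiable ℂ f) {z₀ : ℂ} (h0 : f z₀ ≠ 0)
    (s : ℝ) : ∃ θ ∈ Icc (0 : ℝ) (2 * π), f (Complex.exp (s + θ * Complex.I)) ≠ 0 := by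
  by_contra! hcon
  have hfr : EqOn f 0 (frontier (Metric.ball (0 : ℂ) (exp s))) := by
    intro z hz
    rw [frontier_ball _ (exp_pos s).ne', mem_sphere_zero_iff_norm] at hz
    obtain ⟨n, hn⟩ : ∃ n : ℤ, toIcoMod two_pi_pos 0 z.arg = z.arg - n * (2 * π) :=
      ⟨toIcoDiv two_pi_pos 0 z.arg, by rw [toIcoMod, zsmul_eq_mul]⟩
    have hm := toIcoMod_mem_Ico two_pi_pos 0 z.arg
    rw [hn, zero_add] at hm
    have := hcon _ (Ico_subset_Icc_self hm)
    change f z = 0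
    rw [← this]
    congr 1
    conv_lhs => rw [← Complex.norm_mul_exp_arg_mul_I z, hz]
    rw [Complex.exp_add, Complex.ofReal_exp]
    congr 1
    rw [Complex.exp_eq_exp_iff_exists_int]
    exact ⟨n, by push_cast; ring⟩
  have hball : EqOn f 0 (Metric.ball (0 : ℂ) (exp s)) :=
    Complex.eqOn_of_eqOn_frontier Metric.isBounded_ball hf.diffContOnCl
      (differentiable_const 0).diffContOnCl hfr
  have han : AnalyticOnNhd ℂ f univ := fun z _ => hf.analyticAt z
  have := han.eqOn_zero_of_preconnected_of_eventuallyEq_zero isPreconnected_univ (mem_univ 0)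
    (hball.eventuallyEq_of_mem (Metric.ball_mem_nhds 0 (exp_pos s)))
  exact h0 (this (mem_univ z₀))

/-- A slightly larger closed disc contains finitely many zeros, so their moduli other than `e^s`
stay away from `e^s`. -/
theorem eventually_forall_circle_ne_zero {f : ℂ → ℂ} (hf : Differentiable ℂ f) {z₀ : ℂ}
    (h0 : f z₀ ≠ 0) (s : ℝ) :
    ∀ᶠ s' : ℝ in 𝓝[≠] s, ∀ θ : ℝ, f (Complex.exp (s' + θ * Complex.I)) ≠ 0 := by
  have han : AnalyticOnNhd ℂ f univ := fun z _ => hf.analyticAt z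
  have hfin : (Metric.closedBall (0 : ℂ) (exp s + 1) \ f ⁻¹' {0}ᶜ).Finite :=
    (isCompact_closedBall _ _).finite_sdiff_of_mem_codiscreteWithin
      (codiscreteWithin_mono (subset_univ _) (han.preimage_zero_mem_codiscrete h0))
  have hA := ((hfin.image norm).subset (sdiff_subset (t := {exp s}))).isClosed.isOpen_compl
  have h1 : ∀ᶠ s' in 𝓝 s, exp s' < exp s + 1 :=
    continuous_exp.continuousAt.eventually_lt continuousAt_const (by linarith)
  have h2 : ∀ᶠ s' in 𝓝 s, exp s' ∈ (norm '' (Metric.closedBall (0 : ℂ) (exp s + 1) \ f ⁻¹' {0}ᶜ) \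
      {exp s})ᶜ :=
    continuous_exp.continuousAt.eventually_mem (hA.mem_nhds (by simp))
  filter_upwards [h1.filter_mono nhdsWithin_le_nhds, h2.filter_mono nhdsWithin_le_nhds,
    self_mem_nhdsWithin] with s' hs1 hs2 hs3 θ hθ
  have hnorm : ‖Complex.exp (s' + θ * Complex.I)‖ = exp s' := by
    simp [Complex.norm_exp]
  refine hs2 ⟨⟨Complex.exp (s' + θ * Complex.I), ⟨?_, by simpa using hθ⟩, hnorm⟩, ?_⟩
  · rw [mem_closedBall_zero_iff, hnorm]
    exact hs1.le
  · exact fun h => hs3 (exp_injective h)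

theorem ConvexOn.monotone_of_bddAbove_Iic {N : ℝ → ℝ} (hN : ConvexOn ℝ univ N) {C t₀ : ℝ}
    (hC : ∀ t ≤ t₀, N t ≤ C) : Monotone N := by
  intro x y hxy
  by_contra! hlt
  have hxy' : x < y := hxy.lt_of_ne fun h => by simp [h] at hlt
  have hk : 0 < (N x - N y) / (y - x) := div_pos (by linarith) (by linarith)
  set k := (N x - N y) / (y - x) with hkdef
  -- Chosen so far left that the line of slope `-k` through `(x, N x)` exceeds `C` at `z`, while
  -- convexity keeps `N z` above that line.
  set z := min t₀ (x - (|C - N x| + 1) / k) with hz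
  have hzx : z < x := (min_le_right _ _).trans_lt (by
    have : 0 < (|C - N x| + 1) / k := by positivity
    linarith)
  have h1 := hN.slope_mono_adjacent (mem_univ z) (mem_univ y) hzx hxy'
  have h2 : (N y - N x) / (y - x) = -k := by rw [hkdef]; ring
  rw [h2, div_le_iff₀ (by linarith)] at h1
  have h3 : (|C - N x| + 1) ≤ k * (x - z) := by
    have : (|C - N x| + 1) / k ≤ x - z := by
      have := min_le_right t₀ (x - (|C - N x| + 1) / k)
      linarith
    rwa [div_le_iff₀' hk] at this
  have h4 := hC z (min_le_left _ _)
  have h5 := le_abs_self (C - N x)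
  linarith

/-! ### The main theorem -/

section main

variable {p : ℝ} {f : ℂ → ℂ}

theorem circleMean_exp_eq_regMean (s : ℝ) :
    circleMean p f (exp (2 * s)) = regMean (p / 2) 0 (fun w => f (Complex.exp w)) s := by
  have h : √(exp (2 * s)) = exp s := by
    rw [two_mul, exp_add, sqrt_mul_self (exp_pos s).le]
  simp only [circleMean, regMean, regPow, h, add_zero, Complex.exp_add, Complex.ofReal_exp]
  refine intervalIntegral.integral_congr fun θ _ => ?_
  rw [← rpow_natCast, ← rpow_mul (norm_nonneg _)]
  congr 1
  push_cast
  ring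

theorem circleMean_pos (hp : 0 < p) (hf : Differentiable ℂ f) {z₀ : ℂ} (h0 : f z₀ ≠ 0) {x : ℝ}
    (hx : 0 < x) : 0 < circleMean p f x := by
  obtain ⟨θ, hθ, hne⟩ := exists_ne_zero_on_circle hf h0 (log (√x))
  have hc : Continuous fun θ : ℝ => f ((√x : ℂ) * Complex.exp (θ * Complex.I)) :=
    hf.continuous.comp (by fun_prop)
  refine intervalIntegral.integral_pos two_pi_pos
    (hc.norm.rpow_const fun _ => Or.inr hp.le).continuousOn
    (fun _ _ => by positivity) ⟨θ, hθ, ?_⟩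
  rw [Complex.exp_add, ← Complex.ofReal_exp, exp_log (sqrt_pos.2 hx)] at hne
  exact rpow_pos_of_pos (norm_pos_iff.2 hne) _

/-- The logarithm of the circular mean as a function of `t = ln x`. -/
noncomputable def logCircleMean (p : ℝ) (f : ℂ → ℂ) (t : ℝ) : ℝ := log (circleMean p f (exp t))

theorem logCircleMean_eq (t : ℝ) :
    logCircleMean p f t = log (regMean (p / 2) 0 (fun w => f (Complex.exp w)) (t / 2)) := by
  rw [logCircleMean, ← circleMean_exp_eq_regMean, mul_div_cancel₀ _ two_ne_zero]

theorem differentiable_comp_exp (hf : Differentiable ℂ f) :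
    Differentiable ℂ fun w => f (Complex.exp w) :=
  hf.comp Complex.differentiable_exp

theorem comp_exp_periodic (w : ℂ) :
    f (Complex.exp (w + 2 * π * Complex.I)) = f (Complex.exp w) := by
  rw [Complex.exp_add, Complex.exp_two_pi_mul_I, mul_one]

theorem convexOn_logCircleMean (hp : 0 < p) (hf : Differentiable ℂ f) {z₀ : ℂ} (h0 : f z₀ ≠ 0) :
    ConvexOn ℝ univ (logCircleMean p f) := by
  have h := convexOn_log_regMean_zero (half_pos hp) (differentiable_comp_exp hf)
    comp_exp_periodic fun s => by
      rw [← circleMean_exp_eq_regMean]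
      exact circleMean_pos hp hf h0 (exp_pos _)
  have h2 := h.comp_linearMap ((1 / 2 : ℝ) • LinearMap.id)
  have e : logCircleMean p f = (fun s => log (regMean (p / 2) 0 (fun w => f (Complex.exp w)) s)) ∘
      ((1 / 2 : ℝ) • LinearMap.id : ℝ →ₗ[ℝ] ℝ) := funext fun t => by
    rw [logCircleMean_eq]
    simp [div_eq_inv_mul]
  rw [e]
  exact h2

theorem monotone_logCircleMean (hp : 0 < p) (hf : Differentiable ℂ f) {z₀ : ℂ} (h0 : f z₀ ≠ 0) :
    Monotone (logCircleMean p f) := by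
  obtain ⟨C, hC⟩ := (isCompact_Icc (a := (0 : ℝ)) (b := 1)).exists_bound_of_continuousOn
    (continuous_norm_rpow_circle hp hf.continuous).continuousOn
  refine (convexOn_logCircleMean hp hf h0).monotone_of_bddAbove_Iic (C := log C) (t₀ := 0)
    fun t ht => ?_
  have h1 : (exp (t / 2)) ^ 2 = exp t := by
    rw [← exp_nat_mul]; congr 1; push_cast; ring
  have h2 := hC (exp (t / 2)) ⟨(exp_pos _).le, exp_le_one_iff.2 (by linarith)⟩
  rw [h1] at h2
  exact log_le_log (circleMean_pos hp hf h0 (exp_pos t)) ((le_abs_self _).trans h2)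

/-- Off a discrete set, `logCircleMean` is twice differentiable. -/
theorem eventually_logCircleMean_derivatives (hp : 0 < p) (hf : Differentiable ℂ f) {z₀ : ℂ}
    (h0 : f z₀ ≠ 0) (s : ℝ) :
    ∀ᶠ t in 𝓝[≠] s, ∃ N₁ N₂ : ℝ → ℝ, ∀ᶠ t' in 𝓝 t,
      HasDerivAt (logCircleMean p f) (N₁ t') t' ∧ HasDerivAt N₁ (N₂ t') t' ∧ 0 ≤ N₂ t' := by
  -- Without zeros on the circle no regularisation is needed; the interior supplies the
  -- neighbourhood needed for a second derivative.
  set I : Set ℝ := interior {s | ∀ θ : ℝ, f (Complex.exp (s + θ * Complex.I)) ≠ 0}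
  obtain ⟨L₁, L₂, hL⟩ := log_regMean_derivatives (half_pos hp).le le_rfl
    (differentiable_comp_exp hf) comp_exp_periodic (isOpen_interior (s := {s : ℝ | ∀ θ : ℝ,
      f (Complex.exp (s + θ * Complex.I)) ≠ 0})) fun s hs θ => by
        have := norm_pos_iff.2 (interior_subset hs θ)
        positivity
  have hI : ∀ᶠ s' in 𝓝[≠] (s / 2), s' ∈ I := by
    have h1 := eventually_eventually_nhdsWithin.2 (eventually_forall_circle_ne_zero hf h0 (s / 2))
    filter_upwards [h1, self_mem_nhdsWithin] with s' hs' hne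
    rw [IsOpen.nhdsWithin_eq isOpen_compl_singleton hne] at hs'
    exact mem_interior_iff_mem_nhds.2 hs'
  have hhalf : Tendsto (fun t : ℝ => t / 2) (𝓝[≠] s) (𝓝[≠] (s / 2)) := by
    refine tendsto_nhdsWithin_of_tendsto_nhds_of_eventually_within _ ?_ ?_
    · exact ((continuous_id.div_const 2).tendsto s).mono_left nhdsWithin_le_nhds
    · filter_upwards [self_mem_nhdsWithin] with t ht h
      exact ht (by simpa using h)
  filter_upwards [hhalf.eventually hI] with t ht
  refine ⟨fun t => L₁ (t / 2) / 2, fun t => L₂ (t / 2) / 2 / 2, ?_⟩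
  have hopen : ∀ᶠ t' in 𝓝 t, t' / 2 ∈ I :=
    (continuous_id.div_const 2).continuousAt.eventually_mem (isOpen_interior.mem_nhds ht)
  filter_upwards [hopen] with t' ht'
  obtain ⟨h1, h2, h3⟩ := hL _ ht'
  have hd : HasDerivAt (fun t : ℝ => t / 2) (1 / 2) t' := (hasDerivAt_id t').div_const 2
  refine ⟨?_, ?_, by positivity⟩
  · rw [show logCircleMean p f = _ from funext logCircleMean_eq]
    convert! h1.comp t' hd using 1
    ring
  · exact ((h2.comp t' hd).div_const 2).congr_deriv (by ring)

theorem circleMeanLogDeriv_eq (hp : 0 < p) (hf : Differentiable ℂ f) {z₀ : ℂ} (h0 : f z₀ ≠ 0)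
    {x d : ℝ} (hx : 0 < x) (hd : HasDerivAt (logCircleMean p f) d (log x)) :
    circleMeanLogDeriv p f x = d := by
  have h1 : circleMean p f =ᶠ[𝓝 x] fun x => exp (logCircleMean p f (log x)) := by
    filter_upwards [Ioi_mem_nhds hx] with y hy
    rw [logCircleMean, exp_log hy, exp_log (circleMean_pos hp hf h0 hy)]
  have h2 := (hd.comp x (hasDerivAt_log hx.ne')).exp
  have h3 : deriv (circleMean p f) x = _ := h1.deriv_eq.trans h2.deriv
  rw [circleMeanLogDeriv, h3]
  have h4 : circleMean p f x = exp (logCircleMean p f (log x)) := h1.self_of_nhds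
  simp only [Function.comp_apply]
  rw [← h4]
  have := (circleMean_pos hp hf h0 hx).ne'
  field_simp

/-- Twice the area integral of `|f|^p e^{-α|z|²}`, as a function of `t = ln |z|²`. -/
noncomputable def areaIntegral (p α : ℝ) (f : ℂ → ℂ) (t : ℝ) : ℝ :=
  2 * ∫ ρ in (0 : ℝ)..exp (t / 2), ρ * exp (-α * ρ ^ 2) * circleMean p f (ρ ^ 2)

variable {α : ℝ}

theorem exp_half_sq (t : ℝ) : exp (t / 2) ^ 2 = exp t := by
  rw [← exp_nat_mul]; congr 1; push_cast; ring

theorem continuous_area_integrand (hp : 0 < p) (hf : Continuous f) :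
    Continuous fun ρ : ℝ => ρ * exp (-α * ρ ^ 2) * circleMean p f (ρ ^ 2) :=
  Continuous.mul (by fun_prop) (continuous_norm_rpow_circle hp hf)

theorem hasDerivAt_areaIntegral (hp : 0 < p) (hf : Differentiable ℂ f) {z₀ : ℂ} (h0 : f z₀ ≠ 0)
    (t : ℝ) : HasDerivAt (areaIntegral p α f) (exp (t + -α * exp t + logCircleMean p f t)) t := by
  have hc := continuous_area_integrand (α := α) hp hf.continuous
  have h1 := hc.integral_hasStrictDerivAt 0 (exp (t / 2))
  have h2 : HasDerivAt (fun t : ℝ => exp (t / 2)) (exp (t / 2) * (1 / 2)) t :=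
    ((hasDerivAt_id t).div_const 2).exp
  refine ((h1.hasDerivAt.comp t h2).const_mul 2).congr_deriv ?_
  rw [exp_add, exp_add, logCircleMean, exp_log (circleMean_pos hp hf h0 (exp_pos t)),
    exp_half_sq, ← exp_half_sq t]
  ring

theorem areaIntegral_pos (hp : 0 < p) (hf : Differentiable ℂ f) {z₀ : ℂ} (h0 : f z₀ ≠ 0)
    (t : ℝ) : 0 < areaIntegral p α f t := by
  have hc := continuous_area_integrand (α := α) hp hf.continuous
  refine mul_pos two_pos (intervalIntegral.intervalIntegral_pos_of_pos_on
    (hc.intervalIntegrable _ _) (fun ρ hρ => ?_) (exp_pos _))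
  have hρ0 : 0 < ρ := hρ.1
  have := circleMean_pos hp hf h0 (pow_pos hρ0 2)
  positivity

/-- The circular mean is nondecreasing, so it is bounded by its value on the outer circle. This is
what gives `E/h ≥ v`. -/
theorem areaIntegral_le (hα : α < 0) (hp : 0 < p) (hf : Differentiable ℂ f) {z₀ : ℂ}
    (h0 : f z₀ ≠ 0) (t : ℝ) :
    areaIntegral p α f t * -α ≤ exp (logCircleMean p f t) * (exp (-α * exp t) - 1) := by
  have hc := continuous_area_integrand (α := α) hp hf.continuous
  have hle : ∫ ρ in (0 : ℝ)..exp (t / 2), ρ * exp (-α * ρ ^ 2) * circleMean p f (ρ ^ 2) ≤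
      ∫ ρ in (0 : ℝ)..exp (t / 2), ρ * exp (-α * ρ ^ 2) * exp (logCircleMean p f t) := by
    refine intervalIntegral.integral_mono_on_of_le_Ioo (exp_pos _).le (hc.intervalIntegrable _ _)
      (Continuous.intervalIntegrable (by fun_prop) _ _) fun ρ hρ => ?_
    have hρ0 : 0 < ρ := hρ.1
    have h1 : logCircleMean p f (log (ρ ^ 2)) ≤ logCircleMean p f t := by
      apply monotone_logCircleMean hp hf h0
      rw [← log_exp t, ← exp_half_sq t]
      exact log_le_log (by positivity) (pow_le_pow_left₀ hρ0.le hρ.2.le 2)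
    have h2 : circleMean p f (ρ ^ 2) = exp (logCircleMean p f (log (ρ ^ 2))) := by
      rw [logCircleMean, exp_log (pow_pos hρ0 2), exp_log (circleMean_pos hp hf h0
        (pow_pos hρ0 2))]
    rw [h2]
    gcongr
  rw [intervalIntegral.integral_mul_const, integral_mul_exp_sq (neg_ne_zero.2 hα.ne),
    exp_half_sq] at hle
  have hα' : 0 < -α := neg_pos.2 hα
  calc areaIntegral p α f t * -α ≤
      2 * ((exp (-α * exp t) - 1) / (2 * -α) * exp (logCircleMean p f t)) * -α := by
        unfold areaIntegral
        gcongr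
    _ = _ := by
        have := hα.ne
        field_simp

theorem log_gaussianMean_exp (hα : α < 0) (hp : 0 < p) (hf : Differentiable ℂ f) {z₀ : ℂ}
    (h0 : f z₀ ≠ 0) (s : ℝ) :
    log (gaussianMean p α f (exp s)) = log (areaIntegral p α f (2 * s)) -
      log (exp (-α * exp (2 * s)) - 1) - log (2 * (π / -α)) := by
  have hα' : 0 < -α := neg_pos.2 hα
  have h1 := areaIntegral_pos (α := α) hp hf h0 (2 * s)
  have hy : 0 < exp (-α * exp (2 * s)) - 1 := exp_sub_one_pos (by positivity)
  have hc : 0 < 2 * (π / -α) := by positivity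
  have hs : exp (2 * s / 2) = exp s := by congr 1; ring
  have hs2 : exp s ^ 2 = exp (2 * s) := by rw [← hs, exp_half_sq]
  rw [← log_div h1.ne' hy.ne', ← log_div (by positivity) hc.ne', gaussianMean,
    setIntegral_gaussian_eq hp hf.continuous (exp_pos s).le,
    setIntegral_exp_sq_eq hα.ne (exp_pos s).le, areaIntegral, hs, hs2]
  congr 1
  have := hα.ne
  generalize (∫ ρ in (0 : ℝ)..exp s, ρ * exp (-α * ρ ^ 2) * circleMean p f (ρ ^ 2)) = J
  field_simp

end main

theorem corollary2 (α p : ℝ) (hα : α < 0) (hp : 0 < p)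
    (f : ℂ → ℂ) (hf : Differentiable ℂ f)
    (x₀ : ℝ) (hx₀ : 0 < x₀) (hroot : x₀ * (1 - α * x₀) - gaussPhi α x₀ = 0)
    (hM : ∀ x : ℝ, x₀ ≤ x → DifferentiableAt ℝ (circleMeanLogDeriv p f) x →
      (x * (1 - α * x) - gaussPhi α x) ^ 2 / (4 * x * (gaussPhi α x - x) ^ 2)
        ≤ deriv (circleMeanLogDeriv p f) x) :
    ConvexInLog (fun r : ℝ => Real.log (gaussianMean p α f r)) := by
  by_cases hzero : ∀ z, f z = 0
  -- For `f = 0` the convention `log 0 = 0` makes the function constant.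
  · simp only [ConvexInLog, gaussianMean, hzero, norm_zero, zero_rpow hp.ne', zero_mul,
      integral_zero, zero_div, log_zero]
    exact convexOn_const 0 convex_univ
  push Not at hzero
  obtain ⟨z₀, h0⟩ := hzero
  have hα' : 0 < -α := neg_pos.2 hα
  have hNconv := convexOn_logCircleMean hp hf h0
  have hNmono := monotone_logCircleMean hp hf h0
  have hphi : ∀ x, gaussPhi α x = (exp (-α * x) - 1) / -α := fun x => by
    rw [gaussPhi, div_neg, ← neg_div, neg_sub]
  have hL : ConvexOn ℝ univ fun t =>
      log (areaIntegral p α f t) - log (exp (-α * exp t) - 1) := by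
    -- The right derivative of the convex function `N` is monotone on the whole line, including at
    -- the exceptional points.
    refine convexOn_log_sub_log (y₀ := -α * x₀) (N := logCircleMean p f)
      (m := fun t => derivWithin (logCircleMean p f) (Ioi t) t) hα' ?_
      (areaIntegral_pos hp hf h0) (hasDerivAt_areaIntegral hp hf h0)
      (areaIntegral_le hα hp hf h0)
      (continuousOn_univ.1 (hNconv.continuousOn isOpen_univ)) hNmono ?_ ?_ fun s => ?_
    · rw [hphi, sub_eq_zero, eq_div_iff hα'.ne'] at hroot
      linear_combination -hroot
    · have := hNconv.monotoneOn_rightDeriv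
      rwa [interior_univ, monotoneOn_univ] at this
    · exact fun t => (hNmono.monotoneOn _).derivWithin_nonneg
    · filter_upwards [eventually_logCircleMean_derivatives hp hf h0 s] with t ht
      obtain ⟨N₁, N₂, hN⟩ := ht
      have hm : ∀ᶠ t' in 𝓝 t, derivWithin (logCircleMean p f) (Ioi t') t' = N₁ t' :=
        hN.mono fun t' h => h.1.hasDerivWithinAt.derivWithin (uniqueDiffWithinAt_Ioi t')
      obtain ⟨hd1, hd2, hd3⟩ := hN.self_of_nhds
      refine ⟨?_, N₂ t, hd3, hd2.congr_of_eventuallyEq hm, fun hx => ?_⟩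
      · rw [hm.self_of_nhds]
        exact hd1
      have hx' : x₀ ≤ exp t := le_of_mul_le_mul_left hx hα'
      have hlog : Tendsto log (𝓝 (exp t)) (𝓝 t) := by
        have := (continuousAt_log (exp_pos t).ne').tendsto
        rwa [log_exp] at this
      have heq : circleMeanLogDeriv p f =ᶠ[𝓝 (exp t)] fun x => N₁ (log x) := by
        filter_upwards [hlog.eventually hN, Ioi_mem_nhds (exp_pos t)] with x h1 h2
        exact circleMeanLogDeriv_eq hp hf h0 h2 h1.1
      have hdl : HasDerivAt (circleMeanLogDeriv p f) (N₂ t * (exp t)⁻¹) (exp t) := by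
        refine HasDerivAt.congr_of_eventuallyEq ?_ heq
        exact HasDerivAt.comp_of_eq (exp t) hd2 (hasDerivAt_log (exp_pos t).ne')
          (log_exp t).symm
      have hb := hM _ hx' hdl.differentiableAt
      -- The derivative in `x` is `N₂/x`; this accounts for the factor `x` in the denominator `4x(φ
      -- - x)²`.
      rw [hdl.deriv, ← div_eq_mul_inv, le_div_iff₀ (exp_pos t), hphi] at hb
      refine le_trans (le_of_eq ?_) hb
      have hE := exp_pos t
      have hne := hα.ne
      generalize exp (-α * exp t) - 1 = e
      generalize exp t = x at *
      rw [show x * (1 - α * x) - e / -α = (-α * x * (1 + -α * x) - e) / -α by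
          field_simp
          ring,
        show e / -α - x = (e - -α * x) / -α by
          field_simp
          ring]
      rw [div_pow, div_pow]
      field_simp
  -- The rescaling by 2 is `ln x = 2 ln r`.
  have hcomp := (hL.comp_linearMap ((2 : ℝ) • LinearMap.id)).add_const (-log (2 * (π / -α)))
  unfold ConvexInLog
  refine hcomp.congr fun s _ => ?_
  simp only [log_gaussianMean_exp hα hp hf h0]
  simp [sub_eq_add_neg]
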